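/- All graphs are finite, simple and undirected, and $\alpha(G)$ denotes the independence number of $G$. For integers $k>\ell\ge 0$, a graph $G$ is $(k,\ell)$-stable if $\alpha(G-S)\ge \alpha(G)-\ell$ for every set $S\subseteq V(G)$ with $|S|=k$, where $G-S$ is the subgraph of $G$ induced on $V(G)\setminus S$. For an integer $q\ge 0$, a graph $G$ on $n$ vertices is $q$-tight $(k,\ell)$-stable if $G$ is $(k,\ell)$-stable and $$\alpha(G)=\left\lfloor \frac{n-k+1}{2}\right\rfloor+\ell-q .$$ **Theorem.** Let $k,\ell,q$ be nonnegative integers with $k\ge 2\ell+3$. If $G$ is a $q$-tight $(k,\ell)$-stable graph on $n$ vertices, then $$n\le (q+1)(\ell+1)(k+2q-2\ell-1)^2\,2^{6(k-2\ell+2q)^2}.$$ -/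

import Mathlib

namespace StableGraph

/-- A finite graph `G` is `(k, ℓ)`-stable if `α(G - S) ≥ α(G) - ℓ` for every set `S` of exactly `k`
vertices. Here `α` is the independence number and `G - S` is the subgraph of `G` induced on the
complement of `S`. -/
def IsStable {V : Type*} [Fintype V] (G : SimpleGraph V) (k ℓ : ℕ) : Prop :=
  ∀ S : Finset V, S.card = k →
    ((G.induce ((S : Set V)ᶜ)).indepNum : ℤ) ≥ (G.indepNum : ℤ) - (ℓ : ℤ)

/-- A finite graph `G` on `n` vertices is `q`-tight `(k, ℓ)`-stable if it is `(k, ℓ)`-stable and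
`α(G) = ⌊(n - k + 1) / 2⌋ + ℓ - q`. The equation is between integers, and integer division by `2`
rounds down, also for a negative numerator. -/
def IsTightStable {V : Type*} [Fintype V] (G : SimpleGraph V) (q k ℓ : ℕ) : Prop :=
  IsStable G k ℓ ∧
    (G.indepNum : ℤ) = ((Fintype.card V : ℤ) - (k : ℤ) + 1) / 2 + (ℓ : ℤ) - (q : ℤ)

end StableGraph

namespace StableGraph

universe u

open Finset Relation

/-! As `⌊(n - k + 1) / 2⌋ ≥ (n - k) / 2`, tightness gives `n ≤ 2α + d` with `d = k - 2ℓ + 2q`; of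
stability only deletions of at most `2ℓ + 3` vertices are used. Discarding edges while `α` is kept
makes the graph edge-critical. An isolated vertex is deleted together with a non-isolated one, which
lowers `n` by 2 and `α`, `ℓ` by 1 (`IsRobust.card_vertices_le`). Without isolated vertices, let `A`
be a maximum independent set and `B` its complement: `A` is matched into `B`, and `|B| = |A| + δ`
with `δ ≤ d`.

Sets of vertices of `A` of degree at most two expand by a factor of about `(ℓ + 1) / ℓ`
(`card_mul_le_of_card_nbr_le_two`). As `B` exceeds `A` by only `δ`, their number is bounded by that
of the other vertices of `A`.

For degree at least three (`card_three_le`), a tensor argument shows that `B` spans at most `δ ^ 2`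
edges (`card_edges_le_sq`). Matchings of `A` onto `B` minus `δ` ends of such edges thus have at most
`(2δ²)^δ` types. Criticality of an edge `ab` yields a type whose matchings all use `ab` and have `a`
on no alternating cycle. Three edges at `a` give three matchings, whose pairwise alternating paths
from `a` end in one of `δ` places. Types and ends determine `a`: two vertices sharing them are
joined in opposite directions in any two of the three alternating digraphs, hence in both directions
in one of them (`card_le_of_acyclic`). -/

/-! ### Generic weights, Hall's condition and the edges inside `B`. -/

/-- A field of rational functions provides a weighting of a bipartite graph for which every set of
columns that can be matched into the rows is linearly independent. -/
theorem exists_generic_weights {A B : Type u} [Fintype A] [Fintype B] (r : A → B → Prop) :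
    ∃ (K : Type u) (_ : Field K) (t : A → B → K), (∀ a b, ¬ r a b → t a b = 0) ∧
      ∀ (Z : Finset B) (μ : Z → A), Function.Injective μ → (∀ z, r (μ z) z) →
        ∀ x : B → K, (∀ b ∉ Z, x b = 0) → (∀ a, ∑ b, t a b * x b = 0) → x = 0 := by
  classical
  let S := MvPolynomial (A × B) ℚ
  let p : A → B → S := fun a b => if r a b then MvPolynomial.X (a, b) else 0
  refine ⟨FractionRing S, inferInstance, fun a b => algebraMap S _ (p a b), ?_, ?_⟩
  · intro a b h
    simp [p, h]
  · intro Z μ hμ hr x hx hsum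
    let N : Matrix Z Z S := Matrix.of fun z z' => p (μ z) z'
    have hdet : N.det ≠ 0 := by
      intro h0
      -- Setting the variables of the matching to 1 and all others to 0 turns `N` into the identity,
      -- so its determinant is a nonzero polynomial.
      let f : S →+* ℚ :=
        MvPolynomial.eval (fun q : A × B => if ∃ z : Z, (z : B) = q.2 ∧ μ z = q.1 then 1 else 0)
      have h1 : f.mapMatrix N = 1 := by
        ext z z'
        by_cases hz : z = z'
        · subst hz
          simp only [N, p, f, hr, RingHom.mapMatrix_apply, Matrix.map_apply, Matrix.of_apply,
            Matrix.one_apply_eq, if_true]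
          rw [MvPolynomial.eval_X]
          exact if_pos ⟨z, rfl, rfl⟩
        · have : μ z ≠ μ z' := fun h => hz (hμ h)
          simp only [N, p, f, RingHom.mapMatrix_apply, Matrix.map_apply, Matrix.of_apply,
            Matrix.one_apply_ne hz]
          split_ifs
          · rw [MvPolynomial.eval_X, if_neg]
            rintro ⟨w, hw, hw'⟩
            exact this (hw'.symm.trans (congrArg μ (Subtype.ext hw)))
          · simp
      have h2 := RingHom.map_det f N
      rw [h0, h1] at h2
      simp at h2
    have hdet' : ((algebraMap S (FractionRing S)).mapMatrix N).det ≠ 0 := by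
      rw [← RingHom.map_det]
      exact fun h => hdet ((IsFractionRing.injective S (FractionRing S)) (by rw [h, map_zero]))
    have hz : (fun z : Z => x z) = 0 := by
      apply Matrix.eq_zero_of_mulVec_eq_zero hdet'
      ext z
      have := hsum (μ z)
      rw [← Finset.sum_subset (Finset.subset_univ Z)
        (fun b _ hb => by rw [hx b hb, mul_zero]), ← Finset.sum_coe_sort] at this
      simpa [Matrix.mulVec, dotProduct, N] using this
    ext b
    by_cases hb : b ∈ Z
    · exact congrFun hz ⟨b, hb⟩
    · exact hx b hb

/-- The vertices related to some member of `Z`. -/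
noncomputable def nbr {A B : Type*} [Fintype A] (r : A → B → Prop) (Z : Finset B) : Finset A :=
  open Classical in univ.filter fun a => ∃ z ∈ Z, r a z

theorem mem_nbr {A B : Type*} [Fintype A] {r : A → B → Prop} {Z : Finset B} {a : A} :
    a ∈ nbr r Z ↔ ∃ z ∈ Z, r a z := by
  simp [nbr]

theorem nbr_mono {A B : Type*} [Fintype A] {r : A → B → Prop} {Z Y : Finset B} (h : Z ⊆ Y) :
    nbr r Z ⊆ nbr r Y := fun a ha => by
  obtain ⟨z, hz, hr⟩ := mem_nbr.1 ha
  exact mem_nbr.2 ⟨z, h hz, hr⟩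

theorem nbr_union {A B : Type*} [Fintype A] [DecidableEq A] [DecidableEq B] {r : A → B → Prop}
    (Z Y : Finset B) : nbr r (Z ∪ Y) = nbr r Z ∪ nbr r Y := by
  ext a
  simp only [mem_nbr, mem_union, or_and_right, exists_or]

/-- A set whose subsets satisfy Hall's condition has a matching. -/
theorem exists_matching {A B : Type*} [Fintype A] (r : A → B → Prop)
    (Z : Finset B) (h : ∀ Y ⊆ Z, Y.card ≤ (nbr r Y).card) :
    ∃ μ : Z → A, Function.Injective μ ∧ ∀ z, r (μ z) z := by
  classical
  have := (Finset.all_card_le_biUnion_card_iff_exists_injective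
    (fun z : Z => nbr r {(z : B)})).1 (fun Y => by
      have h1 := h (Y.map (Function.Embedding.subtype _)) (fun y hy => by
        obtain ⟨w, -, rfl⟩ := mem_map.1 hy
        exact w.2)
      rw [card_map] at h1
      refine h1.trans (card_le_card fun a ha => ?_)
      obtain ⟨z, hz, hr⟩ := mem_nbr.1 ha
      obtain ⟨w, hw, rfl⟩ := mem_map.1 hz
      exact mem_biUnion.2 ⟨w, hw, mem_nbr.2 ⟨_, mem_singleton_self _, hr⟩⟩)
  obtain ⟨μ, hμ, hm⟩ := this
  refine ⟨μ, hμ, fun z => ?_⟩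
  obtain ⟨w, hw, hr⟩ := mem_nbr.1 (hm z)
  rwa [mem_singleton.1 hw] at hr

/-- Let `r` be a bipartite graph between `A` and `B` with a matching of `A`, and let `H` be a graph
on `B` each edge of which lies in a set `P`, without further edges of `H`, which has fewer than
`|P|` neighbours in `A`, while sets independent in `H` satisfy Hall's condition. Then `H` has at
most `(|B| - |A|) ^ 2` edges. -/
theorem card_edges_le_sq {A B : Type u} [Fintype A] [Fintype B] (r : A → B → Prop)
    (H : SimpleGraph B) [Fintype H.edgeSet] (δ : ℕ) (hδ : Fintype.card B ≤ Fintype.card A + δ)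
    (hall : ∀ Z : Finset B, H.IsIndepSet Z → Z.card ≤ (nbr r Z).card)
    (ν : A → B) (hν : Function.Injective ν) (hνr : ∀ a, r a (ν a))
    (hcrit : ∀ b c, H.Adj b c → ∃ P : Finset B, b ∈ P ∧ c ∈ P ∧
      (∀ x ∈ P, ∀ y ∈ P, H.Adj x y → s(x, y) = s(b, c)) ∧ (nbr r P).card + 1 ≤ P.card) :
    H.edgeFinset.card ≤ δ ^ 2 := by
  classical
  obtain ⟨K, _, t, ht0, ht⟩ := exists_generic_weights r
  let Φ : (B → K) →ₗ[K] (A → K) := Matrix.mulVecLin (Matrix.of t)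
  have hΦ : ∀ x, x ∈ LinearMap.ker Φ ↔ ∀ a, ∑ b, t a b * x b = 0 := by
    intro x
    rw [LinearMap.mem_ker]
    exact ⟨fun h a => congrFun h a, fun h => funext h⟩
  have hdim : Module.finrank K (LinearMap.ker Φ) ≤ δ := by
    -- The matched columns are independent, so a kernel vector is determined by its coordinates
    -- outside the image of `ν`.
    have hinj : Function.Injective
        ((LinearMap.funLeft K K ((↑) : {b // b ∉ univ.image ν} → B)).comp
          (LinearMap.ker Φ).subtype) := by
      rw [← LinearMap.ker_eq_bot, LinearMap.ker_eq_bot']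
      rintro ⟨x, hx⟩ h
      have hmem : ∀ z : (univ.image ν : Finset B), ∃ a, ν a = z := fun z => by
        simpa using mem_image.1 z.2
      choose μ hμ using hmem
      refine Subtype.ext (ht (univ.image ν) μ (fun z w hzw => Subtype.ext ?_) (fun z => ?_) x
        (fun b hb => congrFun h ⟨b, hb⟩) ((hΦ x).1 hx))
      · rw [← hμ z, ← hμ w, hzw]
      · simpa only [hμ] using hνr (μ z)
    have h1 := LinearMap.finrank_le_finrank_of_injective hinj
    rw [Module.finrank_fintype_fun_eq_card, Fintype.card_subtype_compl] at h1
    simp only [Fintype.card_coe, card_image_of_injective _ hν, card_univ] at h1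
    omega
  have hvec : ∀ b c, H.Adj b c → ∃ x ∈ LinearMap.ker Φ, x b ≠ 0 ∧ x c ≠ 0 ∧
      ∀ y z, H.Adj y z → s(y, z) ≠ s(b, c) → x y * x z = 0 := by
    intro b c hbc
    obtain ⟨P, hb, hc, hP, hcard⟩ := hcrit b c hbc
    let Ψ : (P → K) →ₗ[K] (nbr r P → K) := Matrix.mulVecLin (Matrix.of fun a p => t a p)
    obtain ⟨y, hy, hy0⟩ := Ψ.ker.ne_bot_iff.1 (LinearMap.ker_ne_bot_of_finrank_lt (f := Ψ) (by
      simp only [Module.finrank_fintype_fun_eq_card, Fintype.card_coe]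
      omega))
    let x : B → K := fun b => if h : b ∈ P then y ⟨b, h⟩ else 0
    have hxP : ∀ b ∉ P, x b = 0 := fun b hb => dif_neg hb
    have hxker : ∀ a, ∑ b, t a b * x b = 0 := by
      intro a
      rw [← Finset.sum_subset (Finset.subset_univ P)
        (fun b _ hb => by rw [hxP b hb, mul_zero])]
      by_cases ha : a ∈ nbr r P
      · rw [← Finset.sum_coe_sort]
        have := congrFun (LinearMap.mem_ker.1 hy) ⟨a, ha⟩
        simpa [Ψ, Matrix.mulVec, dotProduct, x] using this
      · refine Finset.sum_eq_zero fun b hb => ?_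
        rw [ht0 a b (fun h => ha (mem_nbr.2 ⟨b, hb, h⟩)), zero_mul]
    have hx0 : x ≠ 0 := by
      intro h
      apply hy0
      ext p
      have := congrFun h p
      simpa [x] using this
    -- Without an end of its only possible `H`-edge, `P` is independent, hence matchable; a kernel
    -- vector vanishing at `d` as well would be zero.
    have hne : ∀ d ∈ P, (d = b ∨ d = c) → x d ≠ 0 := by
      intro d hd hdbc h
      have hind : H.IsIndepSet (P.erase d : Finset B) := by
        intro u hu v hv _ huv
        have hu' := mem_erase.1 (mem_coe.1 hu)
        have hv' := mem_erase.1 (mem_coe.1 hv)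
        have := hP u hu'.2 v hv'.2 huv
        rcases Sym2.eq_iff.1 this with ⟨h1, h2⟩ | ⟨h1, h2⟩ <;> rcases hdbc with h3 | h3 <;>
          subst h1 h2 h3
        exacts [hu'.1 rfl, hv'.1 rfl, hv'.1 rfl, hu'.1 rfl]
      obtain ⟨μ, hμ, hμr⟩ := exists_matching r (P.erase d) (fun Y hY =>
        hall Y (fun u hu v hv => hind (hY hu) (hY hv)))
      refine hx0 (ht _ μ hμ hμr x (fun e he => ?_) hxker)
      by_cases hed : e = d
      · rw [hed, h]
      · exact hxP e (fun h => he (mem_erase.2 ⟨hed, h⟩))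
    refine ⟨x, (hΦ x).2 hxker, hne b hb (.inl rfl), hne c hc (.inr rfl), fun u v huv hne' => ?_⟩
    by_cases hu : u ∈ P
    · by_cases hv : v ∈ P
      · exact absurd (hP u hu v hv huv) hne'
      · rw [hxP v hv, mul_zero]
    · rw [hxP u hu, zero_mul]
  have hout : ∀ e : H.edgeFinset, ∃ b c, H.Adj b c ∧ (e : Sym2 B) = s(b, c) := by
    rintro ⟨e, he⟩
    induction e with
    | _ b c => exact ⟨b, c, by simpa using he, rfl⟩
  choose p q hpq heq using hout
  choose x hxk hxp hxq hx using fun e : H.edgeFinset => hvec (p e) (q e) (hpq e)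
  let L := LinearMap.ker Φ
  let w : H.edgeFinset → TensorProduct K L L := fun e => ⟨x e, hxk e⟩ ⊗ₜ[K] ⟨x e, hxk e⟩
  -- The functionals `y ⊗ z ↦ y (p e) * z (q e)` are dual, up to nonzero scalars, to the tensors `w
  -- e`.
  let ψ : H.edgeFinset → TensorProduct K L L →ₗ[K] K := fun e =>
    TensorProduct.lift ((LinearMap.mul K K).compl₁₂
      ((LinearMap.proj (p e)).comp L.subtype) ((LinearMap.proj (q e)).comp L.subtype))
  have hψ : ∀ e f, ψ e (w f) = x f (p e) * x f (q e) := fun e f => by simp [ψ, w]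
  have hli : LinearIndependent K w := by
    refine (Fintype.linearIndependent_iff (R := K) (M := TensorProduct K L L)).2 fun g hg e => ?_
    have h1 := congrArg (ψ e) hg
    rw [map_sum, map_zero, Finset.sum_eq_single e] at h1
    · rw [map_smul, hψ, smul_eq_mul] at h1
      exact (mul_eq_zero.1 h1).resolve_right (mul_ne_zero (hxp e) (hxq e))
    · intro f _ hfe
      rw [map_smul, hψ, hx f _ _ (hpq e), smul_zero]
      rw [← heq, ← heq]
      exact fun h => hfe (Subtype.ext h.symm)
    · simp
  have h2 := hli.fintype_card_le_finrank
  rw [Fintype.card_coe, Module.finrank_tensorProduct] at h2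
  calc _ ≤ _ := h2
    _ ≤ δ * δ := Nat.mul_le_mul hdim hdim
    _ = δ ^ 2 := (sq δ).symm

/-! ### Alternating paths of two matchings. -/

section Matchings

variable {A B ι : Type*}

/-- A bijection from `B` to `A` with additional elements `ι` is compatible with `r` and `σ` if it
is a perfect matching, along `r`, of `A` with the elements of `B` that are not values of `σ`. -/
def Compatible (r : A → B → Prop) (σ : ι → B) (M : B ≃ A ⊕ ι) : Prop :=
  (∀ a b, M b = Sum.inl a → r a b) ∧ ∀ i, M (σ i) = Sum.inr i

/-- The alternating digraph of a matching. -/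
def Arc (r : A → B → Prop) (M : B ≃ A ⊕ ι) (x y : A) : Prop := r x (M.symm (Sum.inl y))

/-- The element `x` lies on no nontrivial closed walk of the alternating digraph. -/
def Acyclic (r : A → B → Prop) (M : B ≃ A ⊕ ι) (x : A) : Prop :=
  ∀ y, ReflTransGen (Arc r M) x y → ReflTransGen (Arc r M) y x → y = x

/-- The successor of `x` on the alternating path of two matchings. -/
def Step (M N : B ≃ A ⊕ ι) (x y : A) : Prop := M (N.symm (Sum.inl x)) = Sum.inl y

/-- A step leaves `x` by its `N`-edge and enters `y` by its `M`-edge. It is thus an arc for `M`, and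
reversed an arc for `N`. -/
theorem Step.arc_left {r : A → B → Prop} {τ : ι → B} {M N : B ≃ A ⊕ ι} (hN : Compatible r τ N)
    {x y : A} (h : Step M N x y) : Arc r M x y := by
  have : M.symm (Sum.inl y) = N.symm (Sum.inl x) := by rw [← h, Equiv.symm_apply_apply]
  rw [Arc, this]
  exact hN.1 _ _ (by simp)

theorem Step.arc_right {r : A → B → Prop} {σ : ι → B} {M N : B ≃ A ⊕ ι} (hM : Compatible r σ M)
    {x y : A} (h : Step M N x y) : Arc r N y x :=
  hM.1 _ _ h

theorem Step.left_unique {M N : B ≃ A ⊕ ι} {x x' y : A} (h : Step M N x y) (h' : Step M N x' y) :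
    x = x' :=
  Sum.inl_injective (N.symm.injective (M.injective (h.trans h'.symm)))

/-- The alternating path through an element on no alternating cycle leads out of `A`. -/
theorem exists_end [Finite A] [Finite ι] {r : A → B → Prop} {τ : ι → B} {M N : B ≃ A ⊕ ι}
    (hN : Compatible r τ N) {a : A} (ha : Acyclic r M a) (hne : M (N.symm (Sum.inl a)) ≠ Sum.inl a) :
    ∃ i z, ReflTransGen (Step M N) a z ∧ M (N.symm (Sum.inl z)) = Sum.inr i := by
  classical
  by_contra! hcon
  -- A path that never left `A` would follow a cycle of `ρ` back to `a`, a nontrivial closed walk in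
  -- the digraph of `M`.
  let ρ : Equiv.Perm (A ⊕ ι) := N.symm.trans M
  have key : ∀ n y, ReflTransGen (Step M N) a y →
      ∃ z, (ρ ^ n) (Sum.inl y) = Sum.inl z ∧ ReflTransGen (Step M N) y z := by
    intro n
    induction n with
    | zero => exact fun y _ => ⟨y, rfl, .refl⟩
    | succ n ih =>
      intro y hy
      obtain ⟨w, hw⟩ : ∃ w, M (N.symm (Sum.inl y)) = Sum.inl w := by
        cases h : M (N.symm (Sum.inl y)) with
        | inl w => exact ⟨w, rfl⟩
        | inr i => exact absurd h (hcon i y hy)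
      obtain ⟨z, hz, hwz⟩ := ih w (hy.tail hw)
      refine ⟨z, ?_, .head hw hwz⟩
      rw [pow_succ, Equiv.Perm.mul_apply]
      change (ρ ^ n) (M (N.symm (Sum.inl y))) = _
      rw [hw, hz]
  obtain ⟨y, hy⟩ : ∃ w, M (N.symm (Sum.inl a)) = Sum.inl w := by
    cases h : M (N.symm (Sum.inl a)) with
    | inl w => exact ⟨w, rfl⟩
    | inr i => exact absurd h (hcon i a .refl)
  have hay : Step M N a y := hy
  obtain ⟨n, hn, hρ⟩ := (isOfFinOrder_of_finite ρ).exists_pow_eq_one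
  obtain ⟨m, rfl⟩ : ∃ m, n = m + 1 := ⟨n - 1, by omega⟩
  obtain ⟨z, hz, hyz⟩ := key m y (.single hay)
  have : (ρ ^ (m + 1)) (Sum.inl a) = Sum.inl z := by
    rw [pow_succ, Equiv.Perm.mul_apply, ← hz]
    exact congrArg _ hy
  rw [hρ] at this
  obtain rfl : a = z := Sum.inl_injective this
  have := ha y (.single (hay.arc_left hN))
    (ReflTransGen.mono (fun _ _ h => Step.arc_left hN h) _ _ hyz)
  exact hne (by rw [hy, this])

/-- Predecessors are unique, so of two paths with the same end one contains the other. -/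
theorem step_total {M N : B ≃ A ⊕ ι} {a a' z z' : A} {i : ι}
    (h : ReflTransGen (Step M N) a z) (hz : M (N.symm (Sum.inl z)) = Sum.inr i)
    (h' : ReflTransGen (Step M N) a' z') (hz' : M (N.symm (Sum.inl z')) = Sum.inr i) :
    ReflTransGen (Step M N) a a' ∨ ReflTransGen (Step M N) a' a := by
  obtain rfl : z = z' :=
    Sum.inl_injective (N.symm.injective (M.injective (hz.trans hz'.symm)))
  have hu : Relator.RightUnique (Function.swap (Step M N)) := fun _ _ _ h h' => h.left_unique h'
  rcases ReflTransGen.total_of_right_unique hu (reflTransGen_swap.2 h) (reflTransGen_swap.2 h')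
    with h | h
  · exact .inr (reflTransGen_swap.1 h)
  · exact .inl (reflTransGen_swap.1 h)

/-- Two elements on a common path of two matchings are joined in opposite directions in the
alternating digraphs of these matchings. -/
theorem arc_of_step_total {r : A → B → Prop} {σ τ : ι → B} {M N : B ≃ A ⊕ ι}
    (hM : Compatible r σ M) (hN : Compatible r τ N) {a a' : A}
    (h : ReflTransGen (Step M N) a a' ∨ ReflTransGen (Step M N) a' a) :
    (ReflTransGen (Arc r M) a a' ∧ ReflTransGen (Arc r N) a' a) ∨
      (ReflTransGen (Arc r M) a' a ∧ ReflTransGen (Arc r N) a a') := by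
  have key : ∀ {x y}, ReflTransGen (Step M N) x y →
      ReflTransGen (Arc r M) x y ∧ ReflTransGen (Arc r N) y x := fun h =>
    ⟨ReflTransGen.mono (fun _ _ h => Step.arc_left hN h) _ _ h,
      reflTransGen_swap.1 (ReflTransGen.mono (fun _ _ h => Step.arc_right hM h) _ _ h)⟩
  exact h.imp key key

/-- Elements with three neighbours such that each of the three edges belongs to every perfect
matching of `A` to the complement of a suitable set of values, of which there are few. -/
theorem card_le_of_acyclic [Fintype A] [Fintype B] [Fintype ι] (r : A → B → Prop) (R D : Finset _)
    (h : ∀ a b, r a b → ∃ σ : ι → (R : Finset B), (∃ M, Compatible r (fun i => (σ i : B)) M) ∧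
      ∀ M, Compatible r (fun i => (σ i : B)) M → M b = Sum.inl a ∧ Acyclic r M a)
    (hD : ∀ a ∈ (D : Finset A), ∃ b₁ b₂ b₃, r a b₁ ∧ r a b₂ ∧ r a b₃ ∧
      b₁ ≠ b₂ ∧ b₁ ≠ b₃ ∧ b₂ ≠ b₃) :
    D.card ≤ (R.card ^ Fintype.card ι * Fintype.card ι) ^ 3 := by
  classical
  -- One matching is fixed for each `σ`, so that equal signatures refer to the same matchings.
  have hrep : ∀ σ : ι → R, ∃ M : Option (B ≃ A ⊕ ι), ∀ N, Compatible r (fun i => (σ i : B)) N →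
      ∃ N', M = some N' ∧ Compatible r (fun i => (σ i : B)) N' := by
    intro σ
    by_cases hN : ∃ N, Compatible r (fun i => (σ i : B)) N
    · obtain ⟨N, hN⟩ := hN
      exact ⟨some N, fun _ _ => ⟨N, rfl, hN⟩⟩
    · exact ⟨none, fun N h => absurd ⟨N, h⟩ hN⟩
  choose F hF using hrep
  have h' : ∀ a b, r a b → ∃ σ : ι → R, ∃ M, F σ = some M ∧ Compatible r (fun i => (σ i : B)) M ∧
      M b = Sum.inl a ∧ Acyclic r M a := by
    intro a b hab
    obtain ⟨σ, ⟨M, hM⟩, hσ⟩ := h a b hab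
    obtain ⟨N, hN, hN'⟩ := hF σ M hM
    exact ⟨σ, N, hN, hN', hσ N hN'⟩
  have hsymm : ∀ {M : B ≃ A ⊕ ι} {a b}, M b = Sum.inl a → M.symm (Sum.inl a) = b :=
    fun h => by rw [← h, Equiv.symm_apply_apply]
  have hsig : ∀ a : D, ∃ s : ((ι → R) × (ι → R) × (ι → R)) × (ι × ι × ι), ∃ M₁ M₂ M₃ z₁ z₂ z₃,
      (F s.1.1 = some M₁ ∧ F s.1.2.1 = some M₂ ∧ F s.1.2.2 = some M₃) ∧
      (Compatible r (fun i => (s.1.1 i : B)) M₁ ∧ Compatible r (fun i => (s.1.2.1 i : B)) M₂ ∧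
        Compatible r (fun i => (s.1.2.2 i : B)) M₃) ∧
      (Acyclic r M₁ a ∧ Acyclic r M₂ a ∧ Acyclic r M₃ a) ∧
      (ReflTransGen (Step M₁ M₂) a z₁ ∧ M₁ (M₂.symm (Sum.inl z₁)) = Sum.inr s.2.1) ∧
      (ReflTransGen (Step M₁ M₃) a z₂ ∧ M₁ (M₃.symm (Sum.inl z₂)) = Sum.inr s.2.2.1) ∧
      (ReflTransGen (Step M₂ M₃) a z₃ ∧ M₂ (M₃.symm (Sum.inl z₃)) = Sum.inr s.2.2.2) := by
    rintro ⟨a, ha⟩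
    obtain ⟨b₁, b₂, b₃, h₁, h₂, h₃, h₁₂, h₁₃, h₂₃⟩ := hD a ha
    obtain ⟨σ₁, M₁, f₁, c₁, e₁, a₁⟩ := h' a b₁ h₁
    obtain ⟨σ₂, M₂, f₂, c₂, e₂, a₂⟩ := h' a b₂ h₂
    obtain ⟨σ₃, M₃, f₃, c₃, e₃, a₃⟩ := h' a b₃ h₃
    obtain ⟨i₁, z₁, hz₁⟩ := exists_end c₂ a₁ (by
      rw [hsymm e₂, ← e₁]; exact fun h => h₁₂ (M₁.injective h).symm)
    obtain ⟨i₂, z₂, hz₂⟩ := exists_end c₃ a₁ (by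
      rw [hsymm e₃, ← e₁]; exact fun h => h₁₃ (M₁.injective h).symm)
    obtain ⟨i₃, z₃, hz₃⟩ := exists_end c₃ a₂ (by
      rw [hsymm e₃, ← e₂]; exact fun h => h₂₃ (M₂.injective h).symm)
    exact ⟨((σ₁, σ₂, σ₃), (i₁, i₂, i₃)), M₁, M₂, M₃, z₁, z₂, z₃, ⟨f₁, f₂, f₃⟩, ⟨c₁, c₂, c₃⟩,
      ⟨a₁, a₂, a₃⟩, hz₁, hz₂, hz₃⟩
  choose s hs using hsig
  have hinj : Function.Injective s := by
    intro a a' haa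
    obtain ⟨M₁, M₂, M₃, z₁, z₂, z₃, ⟨f₁, f₂, f₃⟩, ⟨c₁, c₂, c₃⟩, ⟨a₁, a₂, a₃⟩, ⟨p₁, q₁⟩, ⟨p₂, q₂⟩,
      ⟨p₃, q₃⟩⟩ := hs a
    obtain ⟨N₁, N₂, N₃, y₁, y₂, y₃, ⟨g₁, g₂, g₃⟩, -, -, ⟨u₁, v₁⟩, ⟨u₂, v₂⟩,
      ⟨u₃, v₃⟩⟩ := hs a'
    rw [← haa] at g₁ g₂ g₃ v₁ v₂ v₃
    obtain rfl := Option.some_injective _ (f₁.symm.trans g₁)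
    obtain rfl := Option.some_injective _ (f₂.symm.trans g₂)
    obtain rfl := Option.some_injective _ (f₃.symm.trans g₃)
    refine Subtype.ext (Eq.symm ?_)
    -- Any two of the three digraphs join `a` and `a'` in opposite directions. With only two
    -- directions available, some digraph has both, and acyclicity there gives equality.
    have t₁₂ := arc_of_step_total c₁ c₂ (step_total p₁ q₁ u₁ v₁)
    have t₁₃ := arc_of_step_total c₁ c₃ (step_total p₂ q₂ u₂ v₂)
    have t₂₃ := arc_of_step_total c₂ c₃ (step_total p₃ q₃ u₃ v₃)
    have a₁ := a₁ a'
    have a₂ := a₂ a'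
    have a₃ := a₃ a'
    tauto
  have := Fintype.card_le_of_injective s hinj
  simp only [Fintype.card_coe, Fintype.card_prod, Fintype.card_fun] at this
  calc _ ≤ _ := this
    _ = _ := by ring

end Matchings

/-! ### Tight sets and the matchings that respect them. -/

section Bipartite

variable {A B : Type*} [Fintype A]

theorem card_le_card_nbr_add [Fintype B] {r : A → B → Prop} {δ : ℕ}
    (hδ : Fintype.card B = Fintype.card A + δ) {ν : A → B} (hν : Function.Injective ν)
    (hνr : ∀ a, r a (ν a)) (Z : Finset B) : Z.card ≤ (nbr r Z).card + δ := by
  classical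
  have h : ((nbr r Z)ᶜ.map ⟨ν, hν⟩) ⊆ Zᶜ := by
    intro b hb
    obtain ⟨a, ha, rfl⟩ := mem_map.1 hb
    exact mem_compl.2 fun hz => mem_compl.1 ha (mem_nbr.2 ⟨_, hz, hνr a⟩)
  have h := card_le_card h
  rw [card_map, card_compl, card_compl] at h
  have := card_le_univ Z
  have := card_le_univ (nbr r Z)
  omega

/-- If the sets that are independent in a graph `H` on `B` satisfy Hall's condition, then a
matching of a tight independent set extends to all of `B`, if `δ` elements that are
adjacent to the non-isolated vertices of `H` are added to `A`. -/
theorem exists_compatible [Fintype B] {r : A → B → Prop} {H : SimpleGraph B} {δ : ℕ}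
    (hδ : Fintype.card B = Fintype.card A + δ)
    (hall : ∀ Z : Finset B, H.IsIndepSet Z → Z.card ≤ (nbr r Z).card)
    {ν : A → B} (hν : Function.Injective ν) (hνr : ∀ a, r a (ν a))
    {R : Finset B} (hR : ∀ b c, H.Adj b c → b ∈ R)
    {P : Finset B} (hP : H.IsIndepSet P) (hcard : (nbr r P).card ≤ P.card) :
    ∃ σ : Fin δ → R, (∃ M, Compatible r (fun i => (σ i : B)) M) ∧ ∀ i, (σ i : B) ∉ P := by
  classical
  -- The neighbours of `P` are reserved for `P`; the `δ` new elements are offered only to members of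
  -- `R` outside `P`.
  let t : B → Finset (A ⊕ Fin δ) := fun c =>
    if c ∈ P then (nbr r {c}).map .inl
    else ((nbr r {c} \ nbr r P).map .inl) ∪ if c ∈ R then univ.map .inr else ∅
  have ht : ∀ Z : Finset B, Z.card ≤ (Z.biUnion t).card := by
    intro Z
    have hsplit : (Z ∩ P).card + (Z \ P).card = Z.card := by
      rw [add_comm]; exact card_sdiff_add_card_inter Z P
    have hN : (nbr r (P ∪ Z \ P)).card = (nbr r P).card + (nbr r (Z \ P) \ nbr r P).card := by
      rw [nbr_union, ← union_sdiff_self_eq_union, card_union_of_disjoint disjoint_sdiff]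
    have hU : (P ∪ Z \ P).card = P.card + (Z \ P).card := card_union_of_disjoint disjoint_sdiff
    have h1 : (Z ∩ P).card ≤ (nbr r (Z ∩ P)).card :=
      hall _ fun x hx y hy => hP (mem_inter.1 (mem_coe.1 hx)).2 (mem_inter.1 (mem_coe.1 hy)).2
    have hdisj : Disjoint (nbr r (Z ∩ P)) (nbr r (Z \ P) \ nbr r P) :=
      disjoint_of_subset_left (nbr_mono inter_subset_right) disjoint_sdiff
    have hsub1 : (nbr r (Z ∩ P) ∪ (nbr r (Z \ P) \ nbr r P)).map
        (.inl : A ↪ A ⊕ Fin δ) ⊆ Z.biUnion t := by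
      intro x hx
      obtain ⟨a, ha, rfl⟩ := mem_map.1 hx
      rcases mem_union.1 ha with ha | ha
      · obtain ⟨z, hz, hr⟩ := mem_nbr.1 ha
        refine mem_biUnion.2 ⟨z, (mem_inter.1 hz).1, ?_⟩
        simp only [t, if_pos (mem_inter.1 hz).2]
        exact mem_map_of_mem _ (mem_nbr.2 ⟨z, mem_singleton_self _, hr⟩)
      · obtain ⟨z, hz, hr⟩ := mem_nbr.1 (mem_sdiff.1 ha).1
        refine mem_biUnion.2 ⟨z, (mem_sdiff.1 hz).1, ?_⟩
        simp only [t, if_neg (mem_sdiff.1 hz).2]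
        exact mem_union_left _ (mem_map_of_mem _
          (mem_sdiff.2 ⟨mem_nbr.2 ⟨z, mem_singleton_self _, hr⟩, (mem_sdiff.1 ha).2⟩))
    -- If `Z \ P` meets `R`, the `δ` new elements make up for any deficiency. Otherwise `P ∪ Z \ P`
    -- is independent in `H` and `hall` applies.
    by_cases hZR : ∃ z ∈ Z \ P, z ∈ R
    · obtain ⟨z, hz, hzR⟩ := hZR
      have hsub2 : (univ : Finset (Fin δ)).map (.inr : Fin δ ↪ A ⊕ Fin δ) ⊆ Z.biUnion t := by
        intro x hx
        refine mem_biUnion.2 ⟨z, (mem_sdiff.1 hz).1, ?_⟩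
        simp only [t, if_neg (mem_sdiff.1 hz).2, if_pos hzR]
        exact mem_union_right _ hx
      have hd : Disjoint ((nbr r (Z ∩ P) ∪ (nbr r (Z \ P) \ nbr r P)).map
          (.inl : A ↪ A ⊕ Fin δ)) ((univ : Finset (Fin δ)).map (.inr : Fin δ ↪ A ⊕ Fin δ)) := by
        rw [Finset.disjoint_left]
        intro x hx hx'
        obtain ⟨a, -, rfl⟩ := mem_map.1 hx
        obtain ⟨i, -, hi⟩ := mem_map.1 hx'
        cases hi
      have h2 := card_le_card (union_subset hsub1 hsub2)
      rw [card_union_of_disjoint hd, card_map, card_map, card_union_of_disjoint hdisj,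
        card_univ, Fintype.card_fin] at h2
      have h3 := card_le_card_nbr_add hδ hν hνr (P ∪ Z \ P)
      omega
    · push Not at hZR
      have h2 := card_le_card hsub1
      rw [card_map, card_union_of_disjoint hdisj] at h2
      have h3 := hall (P ∪ Z \ P) (by
        intro x hx y hy hxy hadj
        rcases mem_union.1 (mem_coe.1 hx) with hx | hx
        · rcases mem_union.1 (mem_coe.1 hy) with hy | hy
          · exact hP hx hy hxy hadj
          · exact hZR y hy (hR _ _ hadj.symm)
        · exact hZR x hx (hR _ _ hadj))
      omega
  obtain ⟨μ, hμ, hμt⟩ := (Finset.all_card_le_biUnion_card_iff_exists_injective t).1 ht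
  have hbij : Function.Bijective μ :=
    (Fintype.bijective_iff_injective_and_card μ).2 ⟨hμ, by simp [hδ]⟩
  let M : B ≃ A ⊕ Fin δ := Equiv.ofBijective μ hbij
  have hMt : ∀ b, M b ∈ t b := hμt
  have hinr : ∀ i, M.symm (Sum.inr i) ∉ P ∧ M.symm (Sum.inr i) ∈ R := by
    intro i
    have h := hMt (M.symm (Sum.inr i))
    rw [Equiv.apply_symm_apply] at h
    by_cases hp : M.symm (Sum.inr i) ∈ P
    · simp [t, hp] at h
    · refine ⟨hp, ?_⟩
      by_contra hr
      simp [t, hp, hr] at h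
  refine ⟨fun i => ⟨M.symm (Sum.inr i), (hinr i).2⟩, ⟨M, fun a b hab => ?_, fun i => ?_⟩,
    fun i => (hinr i).1⟩
  · have h := hMt b
    rw [hab] at h
    by_cases hp : b ∈ P
    · simpa [t, hp, mem_nbr] using h
    · by_cases hr : b ∈ R
      · have : r a b ∧ a ∉ nbr r P := by simpa [t, hp, hr, mem_nbr] using h
        exact this.1
      · have : r a b ∧ a ∉ nbr r P := by simpa [t, hp, hr, mem_nbr] using h
        exact this.1
  · simp

/-- An edge `a b` such that `b` has `a` as the only neighbour outside the neighbourhood of a tight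
set belongs to every matching compatible with the tight set, and lies on no alternating cycle. -/
theorem Compatible.acyclic {ι : Type*} {r : A → B → Prop} {σ : ι → B} {M : B ≃ A ⊕ ι}
    (hM : Compatible r σ M) {P : Finset B} {a : A} {b : B} (hb : b ∉ P) (hbσ : ∀ i, σ i ≠ b)
    (hPσ : ∀ i, σ i ∉ P) (hcard : (nbr r P).card ≤ P.card) (ha : a ∉ nbr r P)
    (hba : ∀ x, r x b → x = a ∨ x ∈ nbr r P) : M b = Sum.inl a ∧ Acyclic r M a := by
  classical
  have hinl : ∀ c, (∀ i, σ i ≠ c) → ∃ x, M c = Sum.inl x := by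
    intro c hc
    cases h : M c with
    | inl x => exact ⟨x, rfl⟩
    | inr i => exact absurd (M.injective ((hM.2 i).trans h.symm)) (hc i)
  -- By tightness, `M` matches `P` onto its whole neighbourhood.
  have hmem : ∀ x ∈ nbr r P, M.symm (Sum.inl x) ∈ P := by
    have himg : P.image M ⊆ (nbr r P).map .inl := by
      intro y hy
      obtain ⟨c, hc, rfl⟩ := mem_image.1 hy
      obtain ⟨x, hx⟩ := hinl c (fun i h => hPσ i (h ▸ hc))
      rw [hx]
      exact mem_map_of_mem _ (mem_nbr.2 ⟨c, hc, hM.1 _ _ hx⟩)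
    have heq := eq_of_subset_of_card_le himg (by
      rw [card_map, card_image_of_injective _ M.injective]
      exact hcard)
    intro x hx
    have : Sum.inl x ∈ P.image M := heq ▸ mem_map_of_mem (.inl : A ↪ A ⊕ ι) hx
    obtain ⟨c, hc, hcx⟩ := mem_image.1 this
    rwa [← hcx, Equiv.symm_apply_apply]
  have hMb : M b = Sum.inl a := by
    obtain ⟨x, hx⟩ := hinl b hbσ
    rcases hba x (hM.1 _ _ hx) with rfl | hx'
    · exact hx
    · refine absurd (hmem x hx') ?_
      rwa [← hx, Equiv.symm_apply_apply]
  refine ⟨hMb, fun y hay hya => ?_⟩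
  -- Walks from `a` never enter the neighbourhood of `P`, and outside it the only possible arc into
  -- `a` is a loop.
  have hstep : ∀ {x y}, x ∉ nbr r P → Arc r M x y → y ∉ nbr r P := fun hx h hy =>
    hx (mem_nbr.2 ⟨_, hmem _ hy, h⟩)
  have hreach : ∀ y, ReflTransGen (Arc r M) a y → y ∉ nbr r P := by
    intro y h
    induction h with
    | refl => exact ha
    | tail _ h ih => exact hstep ih h
  have hback : ∀ y, ReflTransGen (Arc r M) y a → y ∉ nbr r P → y = a := by
    intro y h
    induction h using ReflTransGen.head_induction_on with
    | refl => exact fun _ => rfl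
    | head h _ ih =>
      intro hy
      rw [ih (hstep hy h), Arc, ← hMb, Equiv.symm_apply_apply] at h
      exact (hba _ h).resolve_right hy
  exact hback y hya (hreach y hay)

end Bipartite

/-- The number of elements of `A` with at least three neighbours is bounded in terms of `δ`, in a
bipartite graph between `A` and `B` with `|B| = |A| + δ` and a graph `H` on `B` that together form
a graph with critical edges only, in which `A` is a maximum independent set. -/
theorem card_three_le {A B : Type u} [Fintype A] [Fintype B] (r : A → B → Prop)
    (H : SimpleGraph B) (δ : ℕ) (hδ : Fintype.card B = Fintype.card A + δ)
    (hall : ∀ Z : Finset B, H.IsIndepSet Z → Z.card ≤ (nbr r Z).card)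
    (ν : A → B) (hν : Function.Injective ν) (hνr : ∀ a, r a (ν a))
    (hcrit : ∀ b c, H.Adj b c → ∃ P : Finset B, b ∈ P ∧ c ∈ P ∧
      (∀ x ∈ P, ∀ y ∈ P, H.Adj x y → s(x, y) = s(b, c)) ∧ (nbr r P).card + 1 ≤ P.card)
    (hcrit' : ∀ a b, r a b → ∃ P : Finset B, b ∉ P ∧
      H.IsIndepSet ((insert b (P : Set B)) : Set B) ∧ (nbr r P).card ≤ P.card ∧ a ∉ nbr r P ∧
      ∀ x, r x b → x = a ∨ x ∈ nbr r P)
    (D : Finset A) (hD : ∀ a ∈ D, ∃ b₁ b₂ b₃, r a b₁ ∧ r a b₂ ∧ r a b₃ ∧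
      b₁ ≠ b₂ ∧ b₁ ≠ b₃ ∧ b₂ ≠ b₃) :
    D.card ≤ ((2 * δ ^ 2) ^ δ * δ) ^ 3 := by
  classical
  let R : Finset B := H.edgeFinset.biUnion Sym2.toFinset
  have hRcard : R.card ≤ 2 * δ ^ 2 := by
    have h1 : R.card ≤ H.edgeFinset.card * 2 := by
      refine card_biUnion_le_card_mul _ _ _ fun e _ => ?_
      rw [Sym2.card_toFinset]
      split_ifs <;> omega
    have := card_edges_le_sq r H δ hδ.le hall ν hν hνr hcrit
    omega
  have hR : ∀ b c, H.Adj b c → b ∈ R := fun b c h =>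
    mem_biUnion.2 ⟨s(b, c), by simpa using h, by simp⟩
  have := card_le_of_acyclic (ι := Fin δ) r R D (fun a b hab => by
    obtain ⟨P, hb, hind, hcard, ha, hba⟩ := hcrit' a b hab
    have hnbr : nbr r (insert b P) ⊆ insert a (nbr r P) := by
      intro x hx
      obtain ⟨z, hz, hr⟩ := mem_nbr.1 hx
      rcases mem_insert.1 hz with rfl | hz
      · exact mem_insert.2 (hba x hr)
      · exact mem_insert_of_mem (mem_nbr.2 ⟨z, hz, hr⟩)
    obtain ⟨σ, hσ, hσP⟩ := exists_compatible hδ hall hν hνr hR (P := insert b P)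
      (by rwa [coe_insert]) (by
        rw [card_insert_of_notMem hb]
        exact (card_le_card hnbr).trans ((card_insert_le _ _).trans (by omega)))
    refine ⟨σ, hσ, fun M hM => hM.acyclic hb (fun i h => hσP i ?_) (fun i h => hσP i ?_) hcard ha
      hba⟩
    · rw [h]; exact mem_insert_self _ _
    · exact mem_insert_of_mem h) hD
  rw [Fintype.card_fin] at this
  exact this.trans (Nat.pow_le_pow_left (Nat.mul_le_mul_right _ (Nat.pow_le_pow_left hRcard _)) 3)

/-! ### Vertices of degree at most two. -/

/-- If sets of `ℓ + 1` elements have at least `ℓ + 3` neighbours, then sets of elements with at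
most two neighbours expand. -/
theorem card_mul_le_of_card_nbr_le_two {A B : Type*} [Fintype B] (r : B → A → Prop) (ℓ : ℕ)
    (hall : ∀ T : Finset A, T.card ≤ (nbr r T).card)
    (hexp : ∀ T : Finset A, T.card = ℓ + 1 → ℓ + 3 ≤ (nbr r T).card)
    (X : Finset A) (hX : ∀ a ∈ X, (nbr r {a}).card ≤ 2) :
    X.card * (ℓ + 1) ≤ ℓ * ((nbr r X).card + 1) := by
  classical
  induction X using Finset.strongInduction with
  | H X ih =>
    rcases X.eq_empty_or_nonempty with rfl | ⟨a, ha⟩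
    · simp
    -- A largest member `T` of `F` has at most `ℓ` elements. By maximality, each further vertex
    -- brings two neighbours outside that of `T`, so `T` splits off for the induction.
    let F := X.powerset.filter fun T => T.Nonempty ∧ T.card ≤ ℓ + 1 ∧ (nbr r T).card ≤ T.card + 1
    have hF : F.Nonempty := ⟨{a}, mem_filter.2 ⟨mem_powerset.2 (singleton_subset_iff.2 ha),
      singleton_nonempty a, by simp, by simpa using hX a ha⟩⟩
    obtain ⟨T, hT, hmax⟩ := exists_max_image F card hF
    obtain ⟨hTX, hT0, hTℓ, hTn⟩ := mem_filter.1 hT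
    rw [mem_powerset] at hTX
    have hTle : T.card ≤ ℓ := by
      by_contra h
      have := hexp T (by omega)
      omega
    have hgrow : ∀ b ∈ X \ T, T.card + 2 < (nbr r (insert b T)).card := by
      intro b hb
      by_contra h
      have hb' := mem_sdiff.1 hb
      have hc := card_insert_of_notMem hb'.2
      have := hmax (insert b T) (mem_filter.2 ⟨mem_powerset.2 (insert_subset hb'.1 hTX),
        insert_nonempty _ _, by omega, by omega⟩)
      omega
    have hnb : ∀ b, nbr r (insert b T) = nbr r {b} ∪ nbr r T := fun b => nbr_union {b} T
    by_cases hXT : X = T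
    · subst hXT
      have := hall X
      nlinarith
    have hTX' : T ⊂ X := ssubset_of_subset_of_ne hTX (Ne.symm hXT)
    obtain ⟨b, hbX, hbT⟩ := exists_of_ssubset hTX'
    have hTn' : T.card + 1 ≤ (nbr r T).card := by
      have h1 := hgrow b (mem_sdiff.2 ⟨hbX, hbT⟩)
      rw [hnb] at h1
      have h2 := card_union_le (nbr r {b}) (nbr r T)
      have := hX b hbX
      omega
    have hdisj : Disjoint (nbr r T) (nbr r (X \ T)) := by
      rw [Finset.disjoint_left]
      intro y hy hy'
      obtain ⟨c, hc, hr⟩ := mem_nbr.1 hy'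
      have h1 := hgrow c hc
      rw [hnb] at h1
      have h2 := card_union_add_card_inter (nbr r {c}) (nbr r T)
      have h3 : 0 < (nbr r {c} ∩ nbr r T).card :=
        card_pos.2 ⟨y, mem_inter.2 ⟨mem_nbr.2 ⟨c, mem_singleton_self _, hr⟩, hy⟩⟩
      have := hX c (mem_sdiff.1 hc).1
      omega
    have hN : (nbr r X).card = (nbr r T).card + (nbr r (X \ T)).card := by
      rw [← card_union_of_disjoint hdisj, ← nbr_union, union_sdiff_of_subset hTX]
    have hC : T.card + (X \ T).card = X.card := by
      rw [add_comm]; exact card_sdiff_add_card_eq_card hTX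
    have := ih (X \ T) (sdiff_ssubset hTX hT0) fun c hc => hX c (mem_sdiff.1 hc).1
    rw [hN, ← hC]
    nlinarith

/-! ### Critical graphs. -/

/-- A graph with independence number at most `α`, in which the deletion of any edge allows for
an independent set of size `α + 1`. -/
structure IsCritical {V : Type*} (G : SimpleGraph V) (α : ℕ) : Prop where
  card_le : ∀ I : Finset V, G.IsIndepSet I → I.card ≤ α
  exists_of_adj : ∀ u v, G.Adj u v → ∃ I : Finset V, u ∈ I ∧ v ∈ I ∧ I.card = α + 1 ∧
    ∀ x ∈ I, ∀ y ∈ I, G.Adj x y → s(x, y) = s(u, v)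

namespace IsCritical

variable {V : Type*} [Fintype V] {G : SimpleGraph V} {α : ℕ}

/-- Exchanging the neighbours of `Z` in `A` for `Z` keeps the set independent. -/
theorem card_le_card_nbr_inter [DecidableEq V] (hG : IsCritical G α) {A : Finset V}
    (hA : G.IsIndepSet A) (hAα : A.card = α) {Z : Finset V} (hZ : G.IsIndepSet Z)
    (hZA : Disjoint Z A) : Z.card ≤ (nbr G.Adj Z ∩ A).card := by
  have h := hG.card_le ((A \ nbr G.Adj Z) ∪ Z) (by
    intro x hx y hy hxy hadj
    rcases mem_union.1 (mem_coe.1 hx) with hx | hx <;>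
      rcases mem_union.1 (mem_coe.1 hy) with hy | hy
    · exact hA (mem_sdiff.1 hx).1 (mem_sdiff.1 hy).1 hxy hadj
    · exact (mem_sdiff.1 hx).2 (mem_nbr.2 ⟨y, hy, hadj⟩)
    · exact (mem_sdiff.1 hy).2 (mem_nbr.2 ⟨x, hx, hadj.symm⟩)
    · exact hZ hx hy hxy hadj)
  rw [card_union_of_disjoint (disjoint_of_subset_left sdiff_subset hZA.symm)] at h
  have := card_sdiff_add_card_inter A (nbr G.Adj Z)
  rw [inter_comm] at this
  omega

/-- Criticality puts a neighbour `b` of `T` into an independent set `J` of size `α`. Exchanging `Y =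
J ∩ N(T)` for `T ∩ N(Y)` shows that `|T ∩ N(Y)| ≤ |Y|`; the rest of `T` is smaller and has no
neighbour in `Y`, so induction applies. -/
theorem card_le_card_nbr (hG : IsCritical G α) (hiso : ∀ v, ∃ w, G.Adj v w) (T : Finset V)
    (hT : G.IsIndepSet T) : T.card ≤ (nbr G.Adj T).card := by
  classical
  induction T using Finset.strongInduction with
  | H T ih =>
    by_contra! hlt
    obtain ⟨a, ha⟩ := card_pos.1 (Nat.zero_lt_of_lt hlt)
    obtain ⟨b, hab⟩ := hiso a
    obtain ⟨I, haI, hbI, hI, hcrit⟩ := hG.exists_of_adj a b hab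
    let J := I.erase a
    have hJα : J.card = α := by rw [card_erase_of_mem haI, hI]; rfl
    have hJ : ∀ x ∈ J, ∀ y ∈ J, ¬ G.Adj x y := by
      intro x hx y hy hxy
      have := hcrit x (mem_of_mem_erase hx) y (mem_of_mem_erase hy) hxy
      rcases Sym2.eq_iff.1 this with ⟨h, -⟩ | ⟨-, h⟩
      · exact ne_of_mem_erase hx h
      · exact ne_of_mem_erase hy h
    let Y := J ∩ nbr G.Adj T
    have hbY : b ∈ Y := mem_inter.2 ⟨mem_erase.2 ⟨hab.ne', hbI⟩, mem_nbr.2 ⟨a, ha, hab.symm⟩⟩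
    have haY : a ∈ nbr G.Adj Y := mem_nbr.2 ⟨b, hbY, hab⟩
    have hT' : T \ nbr G.Adj Y ⊂ T := ⟨sdiff_subset, fun h => (mem_sdiff.1 (h ha)).2 haY⟩
    have h1 := ih _ hT' (fun x hx y hy => hT (mem_sdiff.1 hx).1 (mem_sdiff.1 hy).1)
    have h2 : nbr G.Adj (T \ nbr G.Adj Y) ⊆ nbr G.Adj T \ Y := by
      intro y hy
      refine mem_sdiff.2 ⟨nbr_mono sdiff_subset hy, fun hyY => ?_⟩
      obtain ⟨t, ht, hyt⟩ := mem_nbr.1 hy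
      exact (mem_sdiff.1 ht).2 (mem_nbr.2 ⟨y, hyY, hyt.symm⟩)
    have h2 := card_le_card h2
    have h7 : (nbr G.Adj T \ Y).card = (nbr G.Adj T).card - Y.card :=
      card_sdiff_of_subset inter_subset_right
    have h3 : Y.card ≤ (nbr G.Adj T).card := card_le_card inter_subset_right
    have h4 := card_sdiff_add_card_inter T (nbr G.Adj Y)
    have h5 := hG.card_le ((J \ nbr G.Adj T) ∪ (T ∩ nbr G.Adj Y)) (by
      intro x hx y hy hxy hadj
      rcases mem_union.1 (mem_coe.1 hx) with hx | hx <;>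
        rcases mem_union.1 (mem_coe.1 hy) with hy | hy
      · exact hJ x (mem_sdiff.1 hx).1 y (mem_sdiff.1 hy).1 hadj
      · exact (mem_sdiff.1 hx).2 (mem_nbr.2 ⟨y, (mem_inter.1 hy).1, hadj⟩)
      · exact (mem_sdiff.1 hy).2 (mem_nbr.2 ⟨x, (mem_inter.1 hx).1, hadj.symm⟩)
      · exact hT (mem_inter.1 hx).1 (mem_inter.1 hy).1 hxy hadj)
    rw [card_union_of_disjoint (by
      rw [Finset.disjoint_left]
      intro x hx hx'
      obtain ⟨y, hy, hxy⟩ := mem_nbr.1 (mem_inter.1 hx').2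
      exact hJ x (mem_sdiff.1 hx).1 y (mem_inter.1 hy).1 hxy)] at h5
    have h6 : (J \ nbr G.Adj T).card + Y.card = J.card := card_sdiff_add_card_inter _ _
    omega

/-- The independent set of a critical edge `a b` provides a tight subset of the complement of a
maximum independent set containing `a` but not `b`. -/
theorem exists_tight [DecidableEq V] (hG : IsCritical G α) {A : Finset V} (hA : G.IsIndepSet A)
    (hAα : A.card = α) {a b : V} (ha : a ∈ A) (hb : b ∉ A) (hab : G.Adj a b) :
    ∃ P : Finset V, Disjoint P A ∧ b ∉ P ∧ G.IsIndepSet (insert b (P : Set V)) ∧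
      (nbr G.Adj P ∩ A).card ≤ P.card ∧ a ∉ nbr G.Adj P ∧
      ∀ x ∈ A, G.Adj x b → x = a ∨ x ∈ nbr G.Adj P := by
  obtain ⟨I, haI, hbI, hI, hcrit⟩ := hG.exists_of_adj a b hab
  -- Since `|I| = α + 1`, dropping `b` makes `|P| = |A \ I|`. All neighbours of `P` in `A` lie in `A
  -- \ I`, and Hall's condition forces equality.
  let P := (I \ A).erase b
  have hins : insert b P = I \ A := insert_erase (mem_sdiff.2 ⟨hbI, hb⟩)
  have hPA : Disjoint P A := disjoint_of_subset_left (erase_subset _ _) sdiff_disjoint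
  have hPI : ∀ x ∈ P, x ∈ I ∧ x ∉ A ∧ x ≠ b := fun x hx =>
    ⟨(mem_sdiff.1 (mem_of_mem_erase hx)).1, (mem_sdiff.1 (mem_of_mem_erase hx)).2,
      ne_of_mem_erase hx⟩
  have hind : G.IsIndepSet (insert b (P : Set V)) := by
    rw [← coe_insert, hins]
    intro x hx y hy _ hxy
    have hx := mem_sdiff.1 (mem_coe.1 hx)
    have hy := mem_sdiff.1 (mem_coe.1 hy)
    rcases Sym2.eq_iff.1 (hcrit x hx.1 y hy.1 hxy) with ⟨h, -⟩ | ⟨-, h⟩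
    · exact hx.2 (h ▸ ha)
    · exact hy.2 (h ▸ ha)
  have hsub : ∀ x ∈ nbr G.Adj P, x ∉ I := by
    intro x hx hxI
    obtain ⟨p, hp, hxp⟩ := mem_nbr.1 hx
    obtain ⟨h1, h2, h3⟩ := hPI p hp
    rcases Sym2.eq_iff.1 (hcrit x hxI p h1 hxp) with ⟨-, h⟩ | ⟨-, h⟩
    · exact h3 h
    · exact h2 (h ▸ ha)
  have hsub' : nbr G.Adj P ∩ A ⊆ A \ I := fun x hx =>
    mem_sdiff.2 ⟨(mem_inter.1 hx).2, hsub x (mem_inter.1 hx).1⟩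
  have hcard : (A \ I).card = P.card := by
    have h1 := card_sdiff_add_card_inter A I
    have h2 := card_sdiff_add_card_inter I A
    have h3 : P.card + 1 = (I \ A).card := by
      rw [← hins, card_insert_of_notMem (notMem_erase _ _)]
    rw [inter_comm] at h2
    omega
  have heq : nbr G.Adj P ∩ A = A \ I := eq_of_subset_of_card_le hsub' (by
    rw [hcard]
    exact hG.card_le_card_nbr_inter hA hAα
      (fun x hx y hy => hind (Set.mem_insert_of_mem _ hx) (Set.mem_insert_of_mem _ hy)) hPA)
  refine ⟨P, hPA, notMem_erase _ _, hind, by rw [heq, hcard], fun h => hsub a h haI,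
    fun x hx hxb => ?_⟩
  by_cases hxI : x ∈ I
  · rcases Sym2.eq_iff.1 (hcrit x hxI b hbI hxb) with ⟨h, -⟩ | ⟨h, -⟩
    · exact .inl h
    · exact absurd (h ▸ hx) hb
  · have : x ∈ nbr G.Adj P ∩ A := heq ▸ mem_sdiff.2 ⟨hx, hxI⟩
    exact .inr (mem_inter.1 this).1

/-- With both ends of the critical edge outside `A`, the witness is `I \ A`: its neighbours in `A`
lie in `A \ I`, which is smaller by one. -/
theorem exists_deficient [DecidableEq V] (hG : IsCritical G α) {A : Finset V}
    (hAα : A.card = α) {b c : V} (hb : b ∉ A) (hc : c ∉ A) (hbc : G.Adj b c) :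
    ∃ P : Finset V, Disjoint P A ∧ b ∈ P ∧ c ∈ P ∧
      (∀ x ∈ P, ∀ y ∈ P, G.Adj x y → s(x, y) = s(b, c)) ∧
      (nbr G.Adj P ∩ A).card + 1 ≤ P.card := by
  obtain ⟨I, hbI, hcI, hI, hcrit⟩ := hG.exists_of_adj b c hbc
  refine ⟨I \ A, sdiff_disjoint, mem_sdiff.2 ⟨hbI, hb⟩, mem_sdiff.2 ⟨hcI, hc⟩,
    fun x hx y hy => hcrit x (mem_sdiff.1 hx).1 y (mem_sdiff.1 hy).1, ?_⟩
  have hsub : nbr G.Adj (I \ A) ∩ A ⊆ A \ I := by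
    intro x hx
    obtain ⟨hx, hxA⟩ := mem_inter.1 hx
    refine mem_sdiff.2 ⟨hxA, fun hxI => ?_⟩
    obtain ⟨p, hp, hxp⟩ := mem_nbr.1 hx
    rcases Sym2.eq_iff.1 (hcrit x hxI p (mem_sdiff.1 hp).1 hxp) with ⟨h, -⟩ | ⟨h, -⟩
    · exact hb (h ▸ hxA)
    · exact hc (h ▸ hxA)
  have h0 := card_le_card hsub
  have h1 := card_sdiff_add_card_inter A I
  have h2 := card_sdiff_add_card_inter I A
  rw [inter_comm] at h2
  omega

end IsCritical

/-! ### Robust graphs and the removal of isolated vertices. -/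

/-- Removal of at most `k` vertices decreases the independence number `α` by at most `ℓ`. -/
def IsRobust {V : Type*} (G : SimpleGraph V) (α k ℓ : ℕ) : Prop :=
  ∀ S : Finset V, S.card ≤ k → ∃ I : Finset V, G.IsIndepSet I ∧ Disjoint I S ∧ α ≤ I.card + ℓ

/-- A bound for the number of vertices of degree at least three of a critical graph. -/
def branchBound (d : ℕ) : ℕ := ((2 * d ^ 2) ^ d * d) ^ 3

theorem branchBound_mono {d e : ℕ} (h : d ≤ e) : branchBound d ≤ branchBound e := by
  rcases Nat.eq_zero_or_pos d with rfl | hd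
  · simp [branchBound]
  · refine Nat.pow_le_pow_left (Nat.mul_le_mul ?_ h) 3
    calc (2 * d ^ 2) ^ d ≤ (2 * d ^ 2) ^ e := Nat.pow_le_pow_right (by positivity) h
      _ ≤ (2 * e ^ 2) ^ e := Nat.pow_le_pow_left (by gcongr) _

/-- The case without isolated vertices: `A` splits into `D`, of degree at least three, and its
complement, which is bounded through expansion. -/
theorem IsCritical.card_vertices_le {V : Type u} [Fintype V] {G : SimpleGraph V} {α ℓ d : ℕ}
    (hG : IsCritical G α) (hiso : ∀ v, ∃ w, G.Adj v w) {A : Finset V} (hA : G.IsIndepSet A)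
    (hAα : A.card = α) (hrob : IsRobust G α (2 * ℓ + 3) ℓ) (hd : Fintype.card V ≤ 2 * α + d) :
    Fintype.card V ≤ (ℓ + 1) * (2 * branchBound d + 2 * d + 2) := by
  classical
  let r : {v // v ∈ A} → {v // v ∉ A} → Prop := fun a b => G.Adj a b
  let r' : {v // v ∉ A} → {v // v ∈ A} → Prop := fun b a => G.Adj b a
  have hsub : ∀ Z : Finset V, Disjoint Z A → (Z.subtype (· ∉ A)).card = Z.card ∧
      (nbr r (Z.subtype (· ∉ A))).card = (nbr G.Adj Z ∩ A).card := by
    intro Z hZ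
    constructor
    · rw [card_subtype, filter_true_of_mem fun z hz => Finset.disjoint_left.1 hZ hz]
    · rw [← card_map (Function.Embedding.subtype (· ∈ A))]
      congr 1
      ext x
      simp only [mem_map, mem_nbr, mem_subtype, Function.Embedding.subtype_apply, Subtype.exists,
        mem_inter, r]
      constructor
      · rintro ⟨y, hy, ⟨z, hz, hzZ, hyz⟩, rfl⟩
        exact ⟨⟨z, hzZ, hyz⟩, hy⟩
      · rintro ⟨⟨z, hz, hxz⟩, hx⟩
        exact ⟨x, hx, ⟨z, Finset.disjoint_left.1 hZ hz, hz, hxz⟩, rfl⟩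
  have hmapB : ∀ Z : Finset {v // v ∉ A},
      Disjoint (Z.map (Function.Embedding.subtype _)) A ∧
      (Z.map (Function.Embedding.subtype _)).subtype (· ∉ A) = Z := by
    intro Z
    constructor
    · rw [Finset.disjoint_left]
      intro x hx
      obtain ⟨z, -, rfl⟩ := mem_map.1 hx
      exact z.2
    · ext z
      simpa using fun _ => z.2
  have hnbrA : ∀ T : Finset {v // v ∈ A},
      (nbr G.Adj (T.map (Function.Embedding.subtype _))).card = (nbr r' T).card := by
    intro T
    rw [← card_map (Function.Embedding.subtype (· ∉ A))]
    congr 1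
    ext x
    simp only [mem_map, mem_nbr, Function.Embedding.subtype_apply, Subtype.exists, r']
    constructor
    · rintro ⟨_, ⟨z, hz, hzT, rfl⟩, hxz⟩
      exact ⟨x, fun hx => hA hx hz hxz.ne hxz, ⟨z, hz, hzT, hxz⟩, rfl⟩
    · rintro ⟨_, _, ⟨z, hz, hzT, hxz⟩, rfl⟩
      exact ⟨z, ⟨z, hz, hzT, rfl⟩, hxz⟩
  have hindA : ∀ T : Finset {v // v ∈ A},
      G.IsIndepSet (T.map (Function.Embedding.subtype _) : Finset V) := by
    intro T x hx y hy
    obtain ⟨x, -, rfl⟩ := mem_map.1 (mem_coe.1 hx)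
    obtain ⟨y, -, rfl⟩ := mem_map.1 (mem_coe.1 hy)
    exact hA x.2 y.2
  have hallA : ∀ T : Finset {v // v ∈ A}, T.card ≤ (nbr r' T).card := by
    intro T
    have := hG.card_le_card_nbr hiso _ (hindA T)
    rwa [card_map, hnbrA] at this
  obtain ⟨ν, hν, hνr⟩ : ∃ ν : {v // v ∈ A} → {v // v ∉ A}, Function.Injective ν ∧
      ∀ a, r a (ν a) := by
    obtain ⟨μ, hμ, hμr⟩ := exists_matching r' univ fun Y _ => hallA Y
    exact ⟨fun a => μ ⟨a, mem_univ a⟩, fun a b h => congrArg Subtype.val (hμ h),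
      fun a => (hμr ⟨a, mem_univ a⟩).symm⟩
  have hcardA : Fintype.card {v // v ∈ A} = α := by rw [Fintype.card_coe, hAα]
  have hcardB : Fintype.card {v // v ∉ A} + α = Fintype.card V := by
    have := Fintype.card_subtype_compl (· ∈ A)
    have := card_le_univ A
    rw [hcardA] at *
    omega
  obtain ⟨δ, hδ⟩ : ∃ δ, Fintype.card {v // v ∉ A} = Fintype.card {v // v ∈ A} + δ :=
    Nat.exists_eq_add_of_le (Fintype.card_le_of_injective ν hν)
  have hδd : δ ≤ d := by omega
  let D : Finset {v // v ∈ A} := univ.filter fun a => 2 < (nbr r' {a}).card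
  have hDcard : D.card ≤ branchBound d := by
    refine le_trans ?_ (branchBound_mono hδd)
    refine card_three_le r (G.comap (Function.Embedding.subtype _)) δ hδ ?_ ν hν hνr ?_ ?_ D ?_
    · intro Z hZ
      obtain ⟨h1, h2⟩ := hmapB Z
      obtain ⟨-, h4⟩ := hsub _ h1
      have := hG.card_le_card_nbr_inter hA hAα (Z := Z.map (Function.Embedding.subtype _)) (by
        intro x hx y hy hxy
        obtain ⟨x, hx', rfl⟩ := mem_map.1 (mem_coe.1 hx)
        obtain ⟨y, hy', rfl⟩ := mem_map.1 (mem_coe.1 hy)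
        exact hZ hx' hy' (fun h => hxy (congrArg _ h))) h1
      rwa [← h4, h2, card_map] at this
    · rintro ⟨b, hb⟩ ⟨c, hc⟩ hbc
      obtain ⟨P, hPA, hbP, hcP, hP, hcard⟩ := hG.exists_deficient hAα hb hc hbc
      obtain ⟨h1, h2⟩ := hsub P hPA
      refine ⟨P.subtype _, mem_subtype.2 hbP, mem_subtype.2 hcP, fun x hx y hy hxy => ?_,
        by rwa [h1, h2]⟩
      have := hP x (mem_subtype.1 hx) y (mem_subtype.1 hy) hxy
      rcases Sym2.eq_iff.1 this with ⟨h, h'⟩ | ⟨h, h'⟩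
      · exact Sym2.eq_iff.2 (.inl ⟨Subtype.ext h, Subtype.ext h'⟩)
      · exact Sym2.eq_iff.2 (.inr ⟨Subtype.ext h, Subtype.ext h'⟩)
    · rintro ⟨a, ha⟩ ⟨b, hb⟩ hab
      obtain ⟨P, hPA, hbP, hP, hcard, haP, hba⟩ := hG.exists_tight hA hAα ha hb hab
      obtain ⟨h1, h2⟩ := hsub P hPA
      have hmem : ∀ x : {v // v ∈ A}, x ∈ nbr r (P.subtype (· ∉ A)) ↔ (x : V) ∈ nbr G.Adj P := by
        intro x
        simp only [mem_nbr, mem_subtype, Subtype.exists, r]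
        constructor
        · rintro ⟨z, _, hz, h⟩
          exact ⟨z, hz, h⟩
        · rintro ⟨z, hz, h⟩
          exact ⟨z, Finset.disjoint_left.1 hPA hz, hz, h⟩
      refine ⟨P.subtype _, fun h => hbP (mem_subtype.1 h), fun x hx y hy hxy => ?_,
        by rwa [h1, h2], fun h => haP ((hmem _).1 h), fun x hx => ?_⟩
      · refine hP ?_ ?_ (fun h => hxy (Subtype.ext h))
        · rcases hx with rfl | hx
          · exact Set.mem_insert _ _
          · exact Set.mem_insert_of_mem _ (mem_subtype.1 hx)
        · rcases hy with rfl | hy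
          · exact Set.mem_insert _ _
          · exact Set.mem_insert_of_mem _ (mem_subtype.1 hy)
      · exact (hba x x.2 hx).imp Subtype.ext (hmem x).2
    · intro a ha
      obtain ⟨b, hb, c, hc, e, he, h1, h2, h3⟩ := two_lt_card.1 (mem_filter.1 ha).2
      have hr : ∀ b ∈ nbr r' {a}, r a b := by
        intro b hb
        obtain ⟨z, hz, h⟩ := mem_nbr.1 hb
        rw [mem_singleton.1 hz] at h
        exact h.symm
      exact ⟨b, c, e, hr b hb, hr c hc, hr e he, h1, h2, h3⟩
  have hX := card_mul_le_of_card_nbr_le_two r' ℓ hallA (by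
    intro T hT
    by_contra! hlt
    let T' := T.map (Function.Embedding.subtype (· ∈ A))
    have hT' : T'.card = ℓ + 1 := by rw [card_map, hT]
    have hN : (nbr G.Adj T').card ≤ ℓ + 2 := by rw [hnbrA]; omega
    -- Here `2ℓ + 3 = (ℓ + 1) + (ℓ + 2)` is used: adding `T'` to an independent set surviving the
    -- deletion would exceed `α`.
    obtain ⟨I, hI, hIS, hIα⟩ := hrob (T' ∪ nbr G.Adj T') ((card_union_le _ _).trans (by omega))
    rw [disjoint_union_right] at hIS
    have := hG.card_le (I ∪ T') (by
      intro x hx y hy hxy hadj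
      rcases mem_union.1 (mem_coe.1 hx) with hx | hx <;>
        rcases mem_union.1 (mem_coe.1 hy) with hy | hy
      · exact hI hx hy hxy hadj
      · exact Finset.disjoint_left.1 hIS.2 hx (mem_nbr.2 ⟨y, hy, hadj⟩)
      · exact Finset.disjoint_left.1 hIS.2 hy (mem_nbr.2 ⟨x, hx, hadj.symm⟩)
      · exact hindA T hx hy hxy hadj)
    rw [card_union_of_disjoint hIS.1] at this
    omega) Dᶜ (fun a ha => by simpa [D] using ha)
  have h1 := card_le_univ (nbr r' Dᶜ)
  have h2 : Dᶜ.card + D.card = α := by rw [card_compl_add_card, hcardA]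
  have h3 : Dᶜ.card ≤ ℓ * (D.card + δ + 1) := by
    have : ℓ * ((nbr r' Dᶜ).card + 1) ≤ ℓ * (Dᶜ.card + D.card + δ + 1) :=
      Nat.mul_le_mul_left _ (by omega)
    nlinarith
  have h4 : ℓ * (D.card + δ + 1) ≤ ℓ * (branchBound d + d + 1) :=
    Nat.mul_le_mul_left _ (by omega)
  have h5 : Fintype.card V ≤ 2 * (branchBound d + ℓ * (branchBound d + d + 1)) + d := by omega
  nlinarith

/-- An edge-minimal graph subject to the bound `α` works: deleting an edge creates a larger
independent set, which contains both its ends and loses its excess with one of them. -/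
theorem exists_isCritical_le {V : Type*} [Finite V] (G : SimpleGraph V) {α : ℕ}
    (h : ∀ I : Finset V, G.IsIndepSet I → I.card ≤ α) : ∃ H ≤ G, IsCritical H α := by
  classical
  obtain ⟨H, hHG, hH⟩ := exists_minimal_le_of_wellFoundedLT
    (fun H : SimpleGraph V => ∀ I : Finset V, H.IsIndepSet I → I.card ≤ α) G h
  refine ⟨H, hHG, hH.prop, fun u v huv => ?_⟩
  have hlt : H.deleteEdges {s(u, v)} < H :=
    lt_of_le_of_ne (H.deleteEdges_le _) fun h => by
      have : (H.deleteEdges {s(u, v)}).Adj u v := (congrArg (fun K => K.Adj u v) h).mpr huv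
      simp at this
  have hnot := hH.not_prop_of_lt hlt
  push Not at hnot
  obtain ⟨I, hI, hIα⟩ := hnot
  have hadj : ∀ x ∈ I, ∀ y ∈ I, H.Adj x y → s(x, y) = s(u, v) := by
    intro x hx y hy hxy
    by_contra hne
    exact hI hx hy hxy.ne (by rw [SimpleGraph.deleteEdges_adj]; exact ⟨hxy, hne⟩)
  obtain ⟨x, hx, y, hy, hxy⟩ : ∃ x ∈ I, ∃ y ∈ I, H.Adj x y := by
    by_contra! hcon
    have := hH.prop I fun x hx y hy _ => hcon x hx y hy
    omega
  have huvI : u ∈ I ∧ v ∈ I := by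
    rcases Sym2.eq_iff.1 (hadj x hx y hy hxy) with ⟨rfl, rfl⟩ | ⟨rfl, rfl⟩
    exacts [⟨hx, hy⟩, ⟨hy, hx⟩]
  refine ⟨I, huvI.1, huvI.2, ?_, hadj⟩
  have h1 := hH.prop (I.erase u) (by
    intro x hx y hy _ hxy
    have hx := mem_erase.1 (mem_coe.1 hx)
    have hy := mem_erase.1 (mem_coe.1 hy)
    rcases Sym2.eq_iff.1 (hadj x hx.2 y hy.2 hxy) with ⟨h, -⟩ | ⟨-, h⟩
    exacts [hx.1 h, hy.1 h])
  rw [card_erase_of_mem huvI.1] at h1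
  omega

/-- The number of vertices of a graph from which `2 ℓ + 3` vertices can be removed without
decreasing the independence number `α` by more than `ℓ` is bounded in terms of `ℓ` and `n - 2 α`. -/
theorem IsRobust.card_vertices_le (ℓ d : ℕ) : ∀ (V : Type u) [Fintype V] (G : SimpleGraph V)
    (α : ℕ), (∀ I : Finset V, G.IsIndepSet I → I.card ≤ α) →
    (∃ A : Finset V, G.IsIndepSet A ∧ A.card = α) → IsRobust G α (2 * ℓ + 3) ℓ →
    Fintype.card V ≤ 2 * α + d →
    Fintype.card V ≤ (ℓ + 1) * (2 * branchBound d + 2 * d + 2) := by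
  classical
  induction ℓ using Nat.strong_induction_on with
  | _ ℓ ih =>
  rintro V _ G α hle ⟨A, hA, hAα⟩ hrob hd
  obtain ⟨H, hHG, hH⟩ := exists_isCritical_le G hle
  have hindH : ∀ I : Finset V, G.IsIndepSet I → H.IsIndepSet I := fun I hI x hx y hy hxy h =>
    hI hx hy hxy (hHG h)
  have hrobH : IsRobust H α (2 * ℓ + 3) ℓ := fun S hS => by
    obtain ⟨I, hI, h⟩ := hrob S hS
    exact ⟨I, hindH I hI, h⟩
  by_cases hiso : ∀ v, ∃ w, H.Adj v w
  · exact hH.card_vertices_le hiso (hindH A hA) hAα hrobH hd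
  push Not at hiso
  obtain ⟨v, hv⟩ := hiso
  have hinsert : ∀ I : Finset V, H.IsIndepSet I → H.IsIndepSet (insert v I : Finset V) := by
    intro I hI x hx y hy hxy hadj
    rcases mem_insert.1 (mem_coe.1 hx) with rfl | hx
    · exact hv y hadj
    · rcases mem_insert.1 (mem_coe.1 hy) with rfl | hy
      · exact hv x hadj.symm
      · exact hI hx hy hxy hadj
  have hlt : ∀ I : Finset V, H.IsIndepSet I → v ∉ I → I.card + 1 ≤ α := fun I hI hvI => by
    rw [← card_insert_of_notMem hvI]
    exact hH.card_le _ (hinsert I hI)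
  by_cases hedge : ∃ w x, H.Adj w x
  · obtain ⟨w, x, hwx⟩ := hedge
    have hvw : v ≠ w := by
      rintro rfl
      exact hv x hwx
    obtain ⟨m, rfl⟩ : ∃ m, ℓ = m + 1 := by
      obtain ⟨I, hI, hIv, hIα⟩ := hrobH {v} (by simp)
      have := hlt I hI (disjoint_singleton_right.1 hIv)
      exact ⟨ℓ - 1, by omega⟩
    -- Deleting `v` and `w` uses up the two deletions by which `2ℓ + 3` drops as `ℓ` drops by one;
    -- `d` is unchanged since `α` drops by one.
    let W := {u : V // u ∉ ({v, w} : Finset V)}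
    let K : SimpleGraph W := H.comap (Function.Embedding.subtype _)
    have hmap : ∀ I : Finset W, K.IsIndepSet I →
        H.IsIndepSet (I.map (Function.Embedding.subtype _) : Finset V) := by
      intro I hI x hx y hy hxy
      obtain ⟨x, hx', rfl⟩ := mem_map.1 (mem_coe.1 hx)
      obtain ⟨y, hy', rfl⟩ := mem_map.1 (mem_coe.1 hy)
      exact hI hx' hy' (fun h => hxy (congrArg _ h))
    have hsubtype : ∀ I : Finset V, H.IsIndepSet I →
        K.IsIndepSet (I.subtype (· ∉ ({v, w} : Finset V)) : Finset W) := by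
      intro I hI x hx y hy hxy
      exact hI (mem_subtype.1 hx) (mem_subtype.1 hy) (fun h => hxy (Subtype.ext h))
    have hcardW : Fintype.card W + 2 = Fintype.card V := by
      have h1 := Fintype.card_subtype_compl (· ∈ ({v, w} : Finset V))
      rw [Fintype.card_coe, card_pair hvw] at h1
      have h2 := card_le_univ ({v, w} : Finset V)
      rw [card_pair hvw] at h2
      change Fintype.card {u : V // u ∉ ({v, w} : Finset V)} + 2 = _
      omega
    -- Criticality at `w` gives an independent set of size `α` avoiding `w`. It must contain the
    -- isolated `v`, so `α - 1` is attained on `W`.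
    obtain ⟨I₀, hwI, -, hI₀, hcrit⟩ := hH.exists_of_adj w x hwx
    have hJ : H.IsIndepSet (I₀.erase w : Finset V) := by
      intro y hy z hz _ hyz
      have hy := mem_erase.1 (mem_coe.1 hy)
      have hz := mem_erase.1 (mem_coe.1 hz)
      rcases Sym2.eq_iff.1 (hcrit y hy.2 z hz.2 hyz) with ⟨h, -⟩ | ⟨-, h⟩
      exacts [hy.1 h, hz.1 h]
    have hJα : (I₀.erase w).card = α := by rw [card_erase_of_mem hwI, hI₀]; rfl
    have hvJ : v ∈ I₀.erase w := by
      by_contra h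
      have := hlt _ hJ h
      omega
    have hfilter : (I₀.erase w).filter (· ∉ ({v, w} : Finset V)) = (I₀.erase w).erase v := by
      ext y
      simp only [mem_filter, mem_erase, mem_insert, mem_singleton, not_or]
      tauto
    have hα : 0 < α := by
      rw [← hJα]
      exact card_pos.2 ⟨v, hvJ⟩
    have := ih m (Nat.lt_succ_self m) W K (α - 1) (fun I hI => by
      have := hlt _ (hmap I hI) (fun h => by
        obtain ⟨y, -, hy⟩ := mem_map.1 h
        exact y.2 (by simp [show (y : V) = v from hy]))
      rw [card_map] at this
      omega) ⟨(I₀.erase w).subtype _, hsubtype _ hJ, by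
        rw [card_subtype, hfilter, card_erase_of_mem hvJ, hJα]⟩ (fun S hS => by
        obtain ⟨I, hI, hIS, hIα⟩ := hrobH (S.map (Function.Embedding.subtype _) ∪ {v, w}) (by
          refine (card_union_le _ _).trans ?_
          rw [card_map, card_pair hvw]
          omega)
        rw [disjoint_union_right] at hIS
        refine ⟨I.subtype _, hsubtype I hI, ?_, ?_⟩
        · rw [Finset.disjoint_left]
          intro y hy hyS
          exact Finset.disjoint_left.1 hIS.1 (mem_subtype.1 hy) (mem_map_of_mem _ hyS)
        · rw [card_subtype, filter_true_of_mem fun y hy => Finset.disjoint_left.1 hIS.2 hy]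
          omega) (by omega)
    nlinarith
  · push Not at hedge
    have hn := hH.card_le univ fun x _ y _ _ => hedge x y
    rw [card_univ] at hn
    -- In an edgeless graph `α` is at least the number of vertices, so deleting more than `ℓ` of
    -- them is impossible; hence there are at most `ℓ`.
    obtain ⟨S, -, hS⟩ := exists_subset_card_eq
      (s := (univ : Finset V)) (n := min (Fintype.card V) (2 * ℓ + 3)) (by simp)
    obtain ⟨I, -, hIS, hIα⟩ := hrobH S (by omega)
    have := card_le_univ (I ∪ S)
    rw [card_union_of_disjoint hIS] at this
    have : Fintype.card V ≤ ℓ := by omega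
    nlinarith

/-! ### Numerical bounds and the passage from stability to robustness. -/

/-- From `e + 1 ≤ 2 ^ e` the exponent becomes `3 * ((1 + 2e)(e + 1) + e) = 6(e + 1)² - 3`; the spare
factor 8 absorbs the linear terms. -/
theorem branchBound_le (e : ℕ) : 2 * branchBound (e + 1) + 2 * (e + 1) + 2 ≤
    2 ^ (6 * (e + 1) ^ 2) := by
  have he : e + 1 ≤ 2 ^ e := Nat.lt_two_pow_self
  have h1 : branchBound (e + 1) ≤ 2 ^ (6 * (e + 1) ^ 2 - 3) := by
    calc branchBound (e + 1) ≤ ((2 * (2 ^ e) ^ 2) ^ (e + 1) * 2 ^ e) ^ 3 := by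
          unfold branchBound; gcongr
      _ = 2 ^ (((1 + e * 2) * (e + 1) + e) * 3) := by
          rw [← pow_mul, ← pow_succ', ← pow_mul, ← pow_add, ← pow_mul]; ring_nf
      _ = _ := by congr 1; zify [show 3 ≤ 6 * (e + 1) ^ 2 by nlinarith]; ring
  have h2 : 2 ^ (6 * (e + 1) ^ 2) = 8 * 2 ^ (6 * (e + 1) ^ 2 - 3) := by
    rw [show (8 : ℕ) = 2 ^ 3 by norm_num, ← pow_add]
    congr 1
    have : 3 ≤ 6 * (e + 1) ^ 2 := by nlinarith
    omega
  have h3 : 2 ^ e ≤ 2 ^ (6 * (e + 1) ^ 2 - 3) :=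
    Nat.pow_le_pow_right (by norm_num) (Nat.le_sub_of_add_le (by nlinarith))
  omega

theorem IsStable.isRobust {V : Type*} [Fintype V] {G : SimpleGraph V} {k ℓ j : ℕ}
    (hG : IsStable G k ℓ) (hj : j ≤ k) (hk : k ≤ Fintype.card V) :
    IsRobust G G.indepNum j ℓ := by
  classical
  intro S hS
  obtain ⟨T, hST, hT⟩ := exists_superset_card_eq (hS.trans hj) hk
  obtain ⟨I, hI, hIcard⟩ := (G.induce ((T : Set V)ᶜ)).exists_isNIndepSet_indepNum
  refine ⟨I.map (Function.Embedding.subtype _), ?_, ?_, ?_⟩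
  · intro x hx y hy hxy
    obtain ⟨x, hx', rfl⟩ := mem_map.1 (mem_coe.1 hx)
    obtain ⟨y, hy', rfl⟩ := mem_map.1 (mem_coe.1 hy)
    exact hI hx' hy' (fun h => hxy (congrArg _ h))
  · rw [Finset.disjoint_left]
    intro x hx hxS
    obtain ⟨x, hx', rfl⟩ := mem_map.1 hx
    exact x.2 (hST hxS)
  · have := hG T hT
    rw [card_map, hIcard]
    omega

end StableGraph

theorem theorem1p8 {V : Type*} [Fintype V] (G : SimpleGraph V) (k ℓ q n : ℕ)
    (hk : 2 * ℓ + 3 ≤ k) (hn : Fintype.card V = n)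
    (hG : StableGraph.IsTightStable G q k ℓ) :
    n ≤ (q + 1) * (ℓ + 1) * (k + 2 * q - 2 * ℓ - 1) ^ 2 * 2 ^ (6 * (k - 2 * ℓ + 2 * q) ^ 2) := by
  obtain ⟨hst, hα⟩ := hG
  obtain ⟨e, he⟩ : ∃ e, k = 2 * ℓ + 3 + e := Nat.exists_eq_add_of_le hk
  rw [show k + 2 * q - 2 * ℓ - 1 = e + 2 * q + 2 by omega,
    show k - 2 * ℓ + 2 * q = (e + 2 * q + 2) + 1 by omega]
  have hbound : n ≤ (ℓ + 1) *
      (2 * StableGraph.branchBound (e + 2 * q + 2 + 1) + 2 * (e + 2 * q + 2 + 1) + 2) := by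
    -- Extending a deleted set to exactly `k` vertices needs `k ≤ n`; for `n < k` the linear terms
    -- of the bound suffice.
    by_cases hnk : n < k
    · nlinarith [Nat.zero_le (StableGraph.branchBound (e + 2 * q + 2 + 1)),
        Nat.zero_le (ℓ * StableGraph.branchBound (e + 2 * q + 2 + 1)), Nat.zero_le (ℓ * e), Nat.zero_le (ℓ * q)]
    · rw [← hn]
      refine StableGraph.IsRobust.card_vertices_le ℓ _ V G G.indepNum
        (fun I hI => hI.card_le_indepNum) ?_ (hst.isRobust hk (by omega)) (by omega)
      obtain ⟨A, hA⟩ := G.exists_isNIndepSet_indepNum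
      exact ⟨A, hA.isIndepSet, hA.card_eq⟩
  calc n ≤ _ := hbound
    _ ≤ (ℓ + 1) * 2 ^ (6 * (e + 2 * q + 2 + 1) ^ 2) := Nat.mul_le_mul_left _ (StableGraph.branchBound_le _)
    _ ≤ _ := by
      refine Nat.mul_le_mul_right _ ?_
      calc ℓ + 1 = 1 * (ℓ + 1) * 1 := by ring
        _ ≤ _ := Nat.mul_le_mul (Nat.mul_le_mul_right _ (by omega)) (Nat.one_le_pow _ _ (by omega))
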